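/- Let $\sigma=\{R_1,\dots,R_n\}$ be a finite relational signature, $R_i$ of arity $k_i\in\mathbb N$ (possibly $0$), none of whose symbols is unary ($k_i\neq 1$ for all $i$). A $\star$-structure $\mathbf G$ over $\sigma$ is a finite set $G$ together with maps $R_i^{\mathbf G}\colon G^{k_i}\to\{0,1,\star\}$; it is a $01$-structure if no tuple gets the label $\star$. Order the labels by $0\preceq\star$ and $1\preceq\star$, with $0$ and $1$ incomparable. A homomorphism $\mathbf G\to\mathbf H$ is a map $h\colon G\to H$ with $R_i^{\mathbf G}(t)\preceq R_i^{\mathbf H}(h(t))$ for all $i$ and all $t\in G^{k_i}$. For a $\star$-structure $\mathbf H$, $\mathrm{MP}_\star^\sigma(\mathbf H)$ is the problem of deciding whether a given $\star$-structure $\mathbf G$ has a homomorphism to $\mathbf H$, and $\mathrm{MP}^\sigma(\mathbf H)$ is the same problem with inputs restricted to $01$-structures. Structures are given by the size of their domain in unary and the value tables of their symbols. Two decision problems are polynomial-time equivalent if each has a (deterministic) polynomial-time many-one reduction to the other. Two families of decision problems, whose members are named by their template $\mathbf H$, are polynomial-time equivalent if for each problem $P$ of either family one can find, in polynomial time in the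 size of the template of $P$, a problem of the other family that is polynomial-time equivalent to $P$. Theorem. For every $\star$-structure $\mathbf H$ over $\sigma$, the problems $\mathrm{MP}^\sigma(\mathbf H)$ and $\mathrm{MP}_\star^\sigma(\mathbf H)$ are polynomial-time equivalent. Moreover the families $\mathrm{MP}^\sigma$ of all problems $\mathrm{MP}^\sigma(\mathbf H)$ and $\mathrm{MP}_\star^\sigma$ of all problems $\mathrm{MP}_\star^\sigma(\mathbf H)$ are polynomial-time equivalent, both when $\mathbf H$ ranges over all $\star$-structures over $\sigma$ and when it ranges only over those in which no element $x$ satisfies $R(x,\dots,x)=\star$ for all $R\in\sigma$. -/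

import Mathlib

/-- A finite relational signature `{R₁, …, Rₙ}`, the symbol `Rᵢ` having arity `kᵢ`. -/
structure Signature where
  numSymbols : ℕ
  arity : Fin numSymbols → ℕ

/-- The labels `0`, `1`, `⋆` of tuples. -/
inductive Label where
  | zero
  | one
  | star
  deriving DecidableEq

instance Label.instFintype : Fintype Label :=
  ⟨{Label.zero, Label.one, Label.star}, fun a => by cases a <;> simp⟩

/-- The order on labels: `0 ≤ ⋆`, `1 ≤ ⋆`, and `0`, `1` are incomparable. -/
instance Label.instPartialOrder : PartialOrder Label where
  le a b := a = b ∨ b = Label.star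
  le_refl a := Or.inl rfl
  le_trans a b c := by
    rintro (rfl | rfl) (rfl | rfl) <;> simp
  le_antisymm a b := by
    rintro (rfl | rfl) (h | h) <;> simp_all

/-- A `⋆`-structure over `σ`: a finite domain, taken to be `{0, …, size - 1}`, in which every
tuple of the right length carries, for every symbol, a label in `{0, 1, ⋆}`. -/
@[ext]
structure StarStructure (σ : Signature) where
  size : ℕ
  rel : (i : Fin σ.numSymbols) → (Fin (σ.arity i) → Fin size) → Label

namespace StarStructure

variable {σ : Signature}

/-- A map of domains is a homomorphism if labels can only go up. -/
def IsHom (G H : StarStructure σ) (h : Fin G.size → Fin H.size) : Prop :=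
  ∀ (i : Fin σ.numSymbols) (t : Fin (σ.arity i) → Fin G.size),
    G.rel i t ≤ H.rel i (fun j => h (t j))

/-- `01`-structures are the `⋆`-structures without `⋆`-labelled tuples. -/
def Is01 (G : StarStructure σ) : Prop :=
  ∀ (i : Fin σ.numSymbols) (t : Fin (σ.arity i) → Fin G.size), G.rel i t ≠ Label.star

/-- No element `x` satisfies `R(x, …, x) = ⋆` for all symbols `R` simultaneously. -/
def NoStarLoop (H : StarStructure σ) : Prop :=
  ¬ ∃ x : Fin H.size, ∀ i : Fin σ.numSymbols, H.rel i (fun _ => x) = Label.star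

end StarStructure

/-- The alphabet in which structures are written down. -/
inductive StructSymbol where
  | tick
  | sep
  | lab (l : Label)
  deriving DecidableEq, Fintype

namespace StarStructure

variable {σ : Signature}

/-- The value table of the `i`-th symbol; the tuple `t` stands at position
`∑ j, t j * size ^ j`. -/
def table (G : StarStructure σ) (i : Fin σ.numSymbols) : List StructSymbol :=
  List.ofFn fun c : Fin (G.size ^ σ.arity i) =>
    StructSymbol.lab (G.rel i (finFunctionFinEquiv.symm c))

/-- A structure is written as its size in unary, a separator, and the value tables of all
symbols one after the other. -/
def encode (G : StarStructure σ) : List StructSymbol :=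
  List.replicate G.size StructSymbol.tick ++ StructSymbol.sep ::
    (List.ofFn fun i : Fin σ.numSymbols => G.table i).flatten

theorem encode_injective : Function.Injective (encode (σ := σ)) := by
  have key : ∀ (m n : ℕ) (u v : List StructSymbol),
      List.replicate m StructSymbol.tick ++ StructSymbol.sep :: u =
        List.replicate n StructSymbol.tick ++ StructSymbol.sep :: v → m = n ∧ u = v := by
    intro m
    induction m with
    | zero =>
      intro n u v h
      cases n with
      | zero => simpa using h
      | succ n => simp [List.replicate_succ] at h
    | succ m ih =>
      intro n u v h
      cases n with
      | zero => simp [List.replicate_succ] at h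
      | succ n =>
        simp only [List.replicate_succ, List.cons_append, List.cons.injEq, true_and] at h
        obtain ⟨h1, h2⟩ := ih n u v h
        exact ⟨by rw [h1], h2⟩
  rintro ⟨n, r⟩ ⟨m, s⟩ h
  obtain ⟨h1, h2⟩ := key _ _ _ _ h
  simp only at h1
  subst h1
  have h3 := List.ofFn_injective (List.eq_iff_flatten_eq.2 ⟨h2, by
    simp [List.map_ofFn, Function.comp_def, table]⟩)
  simp only [StarStructure.mk.injEq, heq_eq_eq, true_and]
  funext i t
  have h4 := congrFun (List.ofFn_injective (congrFun h3 i)) (finFunctionFinEquiv t)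
  simpa using h4

end StarStructure

section Complexity

open Turing Computability

/-- An injective map into words is an encoding. -/
noncomputable def encodingOfInjective {α Γ : Type} (f : α → List Γ)
    (hf : Function.Injective f) : Encoding α Γ where
  encode := f
  decode := Function.partialInv f
  decode_encode := Function.partialInv_left hf

/-- A decision problem: a set of yes-instances inside a type of instances that are encoded as
words over a finite alphabet. -/
structure DecisionProblem where
  Instance : Type
  Alphabet : Type
  alphabetFintype : Fintype Alphabet
  encoding : Encoding Instance Alphabet
  yes : Set Instance

/-- A polynomial-time (many-one) reduction from `P` to `Q`: a map of instances that preserves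
and reflects yes-instances and is computed by a Turing machine in polynomial time. -/
def DecisionProblem.PolyReducesTo (P Q : DecisionProblem) : Prop :=
  ∃ f : P.Instance → Q.Instance,
    Nonempty (TM2ComputableInPolyTime P.encoding.encode Q.encoding.encode f) ∧
      ∀ x, x ∈ P.yes ↔ f x ∈ Q.yes

/-- Polynomial-time equivalence of two decision problems. -/
def DecisionProblem.PolyEquiv (P Q : DecisionProblem) : Prop :=
  P.PolyReducesTo Q ∧ Q.PolyReducesTo P

/-- A family of decision problems, each of them given by an encoded name (here: a template). -/
structure ProblemFamily where
  Name : Type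
  Alphabet : Type
  alphabetFintype : Fintype Alphabet
  encoding : Encoding Name Alphabet
  problem : Name → DecisionProblem

/-- For every problem of `C` one can find, in polynomial time, a problem of `D` to which it is
polynomial-time equivalent. -/
def ProblemFamily.PolyEmbeds (C D : ProblemFamily) : Prop :=
  ∃ f : C.Name → D.Name,
    Nonempty (TM2ComputableInPolyTime C.encoding.encode D.encoding.encode f) ∧
      ∀ a, (C.problem a).PolyEquiv (D.problem (f a))

/-- Polynomial-time equivalence of two families of decision problems. -/
def ProblemFamily.PolyEquiv (C D : ProblemFamily) : Prop :=
  C.PolyEmbeds D ∧ D.PolyEmbeds C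

/-- The encoding of the structures that satisfy a given property. -/
noncomputable def StarStructure.encodingOn {σ : Signature} (p : StarStructure σ → Prop) :
    Encoding {G : StarStructure σ // p G} StructSymbol :=
  encodingOfInjective (fun G => G.1.encode)
    (StarStructure.encode_injective.comp Subtype.val_injective)

/-- `MP_⋆(H)`: given a `⋆`-structure `G`, is there a homomorphism from `G` to `H`? -/
noncomputable def MPStar {σ : Signature} (H : StarStructure σ) : DecisionProblem where
  Instance := StarStructure σ
  Alphabet := StructSymbol
  alphabetFintype := inferInstance
  encoding := encodingOfInjective StarStructure.encode StarStructure.encode_injective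
  yes := {G | ∃ h, G.IsHom H h}

/-- `MP(H)`: given a `01`-structure `G`, is there a homomorphism from `G` to `H`? -/
noncomputable def MP {σ : Signature} (H : StarStructure σ) : DecisionProblem where
  Instance := {G : StarStructure σ // G.Is01}
  Alphabet := StructSymbol
  alphabetFintype := inferInstance
  encoding := StarStructure.encodingOn StarStructure.Is01
  yes := {G | ∃ h, G.1.IsHom H h}

/-- The problems `MP_⋆(H)`, where `H` ranges over the `⋆`-structures with property `p`. -/
noncomputable def MPStarFamily (σ : Signature) (p : StarStructure σ → Prop) : ProblemFamily where
  Name := {H : StarStructure σ // p H}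
  Alphabet := StructSymbol
  alphabetFintype := inferInstance
  encoding := StarStructure.encodingOn p
  problem H := MPStar H.1

/-- The problems `MP(H)`, where `H` ranges over the `⋆`-structures with property `p`. -/
noncomputable def MPFamily (σ : Signature) (p : StarStructure σ → Prop) : ProblemFamily where
  Name := {H : StarStructure σ // p H}
  Alphabet := StructSymbol
  alphabetFintype := inferInstance
  encoding := StarStructure.encodingOn p
  problem H := MP H.1

end Complexity

/-! An instance of `MP H` is already one of `MPStar H`, so only the converse reduction needs an
argument. Let h be the size of `H`. Replace every element of `G` by N copies, keep the labels 0 and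
1, and resolve a ⋆ on a tuple of copies by an N × N bit matrix M, read at the indices of the first
two copies. A homomorphism from `G` composes with the projection. Conversely, a homomorphism from
the blow-up colours the copies of each x with h colours; send x to a colour selected from this
colouring. If any two selected classes span both bits of M, the image of a ⋆-tuple lies above both 0
and 1, so it is ⋆ (`exists_hom_copies_iff`). A nullary ⋆ is resolved against the label in `H`; a
unary symbol would offer no second index.

For M (`exists_matrix_forall_selection`), take as indices the pairs (i, v) with i < n = h² and v a
bit vector of length n; the entry at (i, v), (i', v') is the i-th bit of v'. A class containing at
least 1/h of all pairs has at least h first coordinates and at least 2^n / h second ones. Were the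
bits constant on two such classes, at most 2^(n-h) vectors would remain, contradicting h < 2^h.

N and M depend on `H` alone, so the blow-up takes polynomial time. `StarStructure.polyTime_copies`
proves this by a program in a small stack language, compiled by `StackProg.polyTime`. The template
never changes, so the families are matched by the identity on names. -/

/-! ### Stack programs and their compilation to Turing machines. -/

/-- Programs acting on finitely many stacks, indexed by `K`, with entries in `Γ`. -/
inductive StackProg (K Γ : Type) where
  /-- push the listed symbols -/
  | emit (l : List (K × Γ))
  /-- pop a symbol `a` from `k` and push the symbols obtained from `a` -/
  | xfer (k : K) (l : List (K × (Γ → Γ)))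
  | seq (p q : StackProg K Γ)
  /-- pop a symbol `a` from `k`; as long as there is one and it satisfies `P`, push the symbols
  obtained from `a`, run `p`, and repeat -/
  | loop (k : K) (P : Γ → Bool) (l : List (K × (Γ → Γ))) (p : StackProg K Γ)

namespace StackProg

open Function Turing StateTransition

variable {K Γ : Type}

/-- Push a list of symbols, the head of the list first. -/
def pushes [DecidableEq K] : (K → List Γ) → List (K × Γ) → K → List Γ
  | S, [] => S
  | S, x :: l => pushes (update S x.1 (x.2 :: S x.1)) l

/-- The symbols pushed in response to the popped symbol `a`. -/
def respond (l : List (K × (Γ → Γ))) (a : Γ) : List (K × Γ) :=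
  l.map fun x => (x.1, x.2 a)

/-- `Exec p S S' t`: the program `p` turns the stacks `S` into `S'` in exactly `t` steps. -/
inductive Exec [DecidableEq K] :
    StackProg K Γ → (K → List Γ) → (K → List Γ) → ℕ → Prop where
  | emit (l S) : Exec (emit l) S (pushes S l) 1
  | xfer {k l S a w} (h : S k = a :: w) :
      Exec (xfer k l) S (pushes (update S k w) (respond l a)) 1
  | seq {p q S S' S'' t t'} (h : Exec p S S' t) (h' : Exec q S' S'' t') :
      Exec (seq p q) S S'' (t + t')
  | loop_nil {k P l p S} (h : S k = []) : Exec (loop k P l p) S S 1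
  | loop_exit {k P l p S a w} (h : S k = a :: w) (hP : P a = false) :
      Exec (loop k P l p) S (update S k w) 1
  | loop_step {k P l p S S' S'' a w t t'} (h : S k = a :: w) (hP : P a = true)
      (h₁ : Exec p (pushes (update S k w) (respond l a)) S' t)
      (h₂ : Exec (loop k P l p) S' S'' t') :
      Exec (loop k P l p) S S'' (1 + t + t')

/-- The control points of a program. -/
def Pos : StackProg K Γ → Type
  | emit _ => Unit
  | xfer _ _ => Unit
  | seq p q => p.Pos ⊕ q.Pos
  | loop _ _ _ p => Option p.Pos

/-- The control point at which a program starts. -/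
def entry : (p : StackProg K Γ) → p.Pos
  | emit _ => ()
  | xfer _ _ => ()
  | seq p _ => Sum.inl p.entry
  | loop _ _ _ _ => none

/-- A program has finitely many control points. -/
@[reducible]
def posFintype : (p : StackProg K Γ) → Fintype p.Pos
  | emit _ => inferInstanceAs (Fintype Unit)
  | xfer _ _ => inferInstanceAs (Fintype Unit)
  | seq p q =>
    let _ := p.posFintype
    let _ := q.posFintype
    inferInstanceAs (Fintype (p.Pos ⊕ q.Pos))
  | loop _ _ _ p =>
    let _ := p.posFintype
    inferInstanceAs (Fintype (Option p.Pos))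

section Compile

variable {Λ : Type}

/-- Go to a label, or halt if there is none. -/
def leave : Option Λ → TM2.Stmt (fun _ : K => Γ) Λ (Option Γ)
  | some l => TM2.Stmt.goto fun _ => l
  | none => TM2.Stmt.halt

/-- The statement that pushes the given symbols. -/
def pushStmt (q : TM2.Stmt (fun _ : K => Γ) Λ (Option Γ)) :
    List (K × Γ) → TM2.Stmt (fun _ : K => Γ) Λ (Option Γ)
  | [] => q
  | x :: l => TM2.Stmt.push x.1 (fun _ => x.2) (pushStmt q l)

/-- The statement that pushes the symbols computed from the symbol in the register. -/
def respondStmt [Inhabited Γ] (q : TM2.Stmt (fun _ : K => Γ) Λ (Option Γ)) :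
    List (K × (Γ → Γ)) → TM2.Stmt (fun _ : K => Γ) Λ (Option Γ)
  | [] => q
  | x :: l => TM2.Stmt.push x.1 (fun v => x.2 (v.getD default)) (respondStmt q l)

/-- The statement that tests whether to run the body of a loop, placed at `body`, once more. -/
def loopStmt [Inhabited Γ] (k : K) (P : Γ → Bool) (l : List (K × (Γ → Γ))) (body : Λ)
    (ex : Option Λ) : TM2.Stmt (fun _ : K => Γ) Λ (Option Γ) :=
  TM2.Stmt.pop k (fun _ o => o)
    (TM2.Stmt.branch (fun v => v.any P)
      (respondStmt (TM2.Stmt.load (fun _ => none) (TM2.Stmt.goto fun _ => body)) l)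
      (TM2.Stmt.load (fun _ => none) (leave ex)))

/-- The machine code of a program whose control points are placed by `emb` and which proceeds to
`ex` when it ends. -/
def code [Inhabited Γ] : (p : StackProg K Γ) → (p.Pos → Λ) → Option Λ → p.Pos →
    TM2.Stmt (fun _ : K => Γ) Λ (Option Γ)
  | emit l, _, ex, _ => pushStmt (leave ex) l
  | xfer k l, _, ex, _ =>
    TM2.Stmt.pop k (fun _ o => o) (respondStmt (TM2.Stmt.load (fun _ => none) (leave ex)) l)
  | seq p q, emb, ex, x =>
    Sum.elim (code p (fun y => emb (Sum.inl y)) (some (emb (Sum.inr q.entry))))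
      (code q (fun y => emb (Sum.inr y)) ex) x
  | loop k P l p, emb, ex, x =>
    Option.elim x (loopStmt k P l (emb (some p.entry)) ex)
      (code p (fun y => emb (some y)) (some (emb none)))

variable [DecidableEq K]

theorem stepAux_leave (ex : Option Λ) (v : Option Γ) (S : K → List Γ) :
    TM2.stepAux (leave ex) v S = ⟨ex, v, S⟩ := by
  cases ex <;> rfl

theorem stepAux_pushStmt (q : TM2.Stmt (fun _ : K => Γ) Λ (Option Γ)) (v : Option Γ)
    (l : List (K × Γ)) (S : K → List Γ) :
    TM2.stepAux (pushStmt q l) v S = TM2.stepAux q v (pushes S l) := by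
  induction l generalizing S with
  | nil => rfl
  | cons x l ih => exact ih _

theorem stepAux_respondStmt [Inhabited Γ] (q : TM2.Stmt (fun _ : K => Γ) Λ (Option Γ)) (a : Γ)
    (l : List (K × (Γ → Γ))) (S : K → List Γ) :
    TM2.stepAux (respondStmt q l) (some a) S =
      TM2.stepAux q (some a) (pushes S (respond l a)) := by
  induction l generalizing S with
  | nil => rfl
  | cons x l ih => exact ih _

/-- Every fragment is entered and left with an empty register. This makes fragments composable and
agrees with the prescribed halting configuration. -/
theorem Exec.iterate_step [Inhabited Γ] {p : StackProg K Γ} {S S' : K → List Γ} {t : ℕ}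
    (h : Exec p S S' t) (emb : p.Pos → Λ) (ex : Option Λ)
    (m : Λ → TM2.Stmt (fun _ : K => Γ) Λ (Option Γ)) (hm : ∀ x, m (emb x) = p.code emb ex x) :
    (flip bind (TM2.step m))^[t] (some ⟨some (emb p.entry), none, S⟩) = some ⟨ex, none, S'⟩ := by
  induction h generalizing ex with
  | emit l S =>
    have h1 : m (emb ()) = pushStmt (leave ex) l := hm ()
    simp only [iterate_one, flip, Option.bind_eq_bind, Option.bind_some, entry, TM2.step]
    rw [h1, stepAux_pushStmt, stepAux_leave]
  | @xfer k l S a w h =>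
    have h1 : m (emb ()) = TM2.Stmt.pop k (fun _ o => o)
        (respondStmt (TM2.Stmt.load (fun _ => none) (leave ex)) l) := hm ()
    simp only [iterate_one, flip, Option.bind_eq_bind, Option.bind_some, entry, TM2.step]
    rw [h1]
    simp only [TM2.stepAux, h, List.head?_cons, List.tail_cons]
    rw [stepAux_respondStmt, TM2.stepAux, stepAux_leave]
  | @seq p q S S' S'' t t' _ _ ih ih' =>
    rw [add_comm, iterate_add_apply]
    have h1 := ih (fun y => emb (Sum.inl y)) (some (emb (Sum.inr q.entry))) fun x => hm (Sum.inl x)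
    have h2 := ih' (fun y => emb (Sum.inr y)) ex fun x => hm (Sum.inr x)
    exact (congrArg _ h1).trans h2
  | @loop_nil k P l p S h =>
    have h1 : m (emb none) = loopStmt k P l (emb (some p.entry)) ex := hm none
    simp only [iterate_one, flip, Option.bind_eq_bind, Option.bind_some, entry, TM2.step]
    rw [h1]
    simp only [loopStmt, TM2.stepAux, h, List.head?_nil, List.tail_nil, Option.any_none,
      cond_false]
    rw [stepAux_leave, ← h, update_eq_self]
  | @loop_exit k P l p S a w h hP =>
    have h1 : m (emb none) = loopStmt k P l (emb (some p.entry)) ex := hm none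
    simp only [iterate_one, flip, Option.bind_eq_bind, Option.bind_some, entry, TM2.step]
    rw [h1]
    simp only [loopStmt, TM2.stepAux, h, List.head?_cons, List.tail_cons, Option.any_some,
      hP, cond_false]
    rw [stepAux_leave]
  | @loop_step k P l p S S' S'' a w t t' h hP _ _ ih ih' =>
    -- Iterates compose from the right: the test comes first, then the body, then the remaining
    -- rounds.
    rw [show 1 + t + t' = t' + (t + 1) by ring, iterate_add_apply, iterate_add_apply, iterate_one]
    have h1 : m (emb none) = loopStmt k P l (emb (some p.entry)) ex := hm none
    have h2 : flip bind (TM2.step m) (some ⟨some (emb none), none, S⟩) =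
        some ⟨some (emb (some p.entry)), none, pushes (update S k w) (respond l a)⟩ := by
      simp only [flip, Option.bind_eq_bind, Option.bind_some, TM2.step]
      rw [h1]
      simp only [loopStmt, TM2.stepAux, h, List.head?_cons, List.tail_cons, Option.any_some,
        hP, cond_true]
      rw [stepAux_respondStmt]
      rfl
    have h3 := ih (fun y => emb (some y)) (some (emb none)) fun x => hm (some x)
    exact (congrArg _ ((congrArg _ h2).trans h3)).trans (ih' emb ex hm)

/-- A function computed by a stack program in polynomial time is computed by a Turing machine in
polynomial time. -/
theorem polyTime [Fintype K] [Fintype Γ] [Inhabited Γ] {α β : Type} {ea : α → List Γ}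
    {eb : β → List Γ} {f : α → β} (p : StackProg K Γ) (k₀ k₁ : K) (time : Polynomial ℕ)
    (h : ∀ a, ∃ t ≤ time.eval (ea a).length,
      Exec p (fun k => if k = k₀ then ea a else []) (fun k => if k = k₁ then eb (f a) else []) t) :
    Nonempty (TM2ComputableInPolyTime ea eb f) := by
  let _ := p.posFintype
  let tm : FinTM2 :=
    { K := K
      k₀ := k₀
      k₁ := k₁
      Γ := fun _ => Γ
      Λ := p.Pos
      main := p.entry
      σ := Option Γ
      initialState := none
      m := p.code id none }
  refine ⟨⟨⟨tm, Equiv.refl Γ, Equiv.refl Γ⟩, time, fun a => Classical.choice ?_⟩⟩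
  obtain ⟨t, ht, hp⟩ := h a
  refine ⟨⟨⟨t, ?_⟩, ht⟩⟩
  have h1 := hp.iterate_step id none tm.m fun _ => rfl
  have h2 : initList tm (List.map (Equiv.refl Γ).invFun (ea a)) =
      ⟨some p.entry, none, fun k => if k = k₀ then ea a else []⟩ := by
    unfold initList
    congr 1
    funext k
    by_cases hk : k = k₀
    · have hk := hk.symm; subst hk; simp [tm]
    · simp [tm, hk]
  have h3 : haltList tm (List.map (Equiv.refl Γ).invFun (eb (f a))) =
      ⟨none, none, fun k => if k = k₁ then eb (f a) else []⟩ := by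
    unfold haltList
    congr 1
    funext k
    by_cases hk : k = k₁
    · have hk := hk.symm; subst hk; simp [tm]
    · simp [tm, hk]
  rw [Option.map_some, h2, h3]
  exact h1

end Compile

end StackProg

/-! ### Time bounds for composite programs, loops and counters. -/

namespace StackProg

open Function

variable {K Γ : Type} [DecidableEq K]

/-- The program `p` turns the stacks `S` into `S'` in at most `T` steps. -/
def Does (p : StackProg K Γ) (S S' : K → List Γ) (T : ℕ) : Prop :=
  ∃ t ≤ T, Exec p S S' t

theorem Does.mono {p : StackProg K Γ} {S S' : K → List Γ} {T T' : ℕ} (h : Does p S S' T)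
    (hT : T ≤ T') : Does p S S' T' := by
  obtain ⟨t, ht, hp⟩ := h
  exact ⟨t, ht.trans hT, hp⟩

theorem Does.seq {p q : StackProg K Γ} {S S' S'' : K → List Γ} {T T' : ℕ} (h : Does p S S' T)
    (h' : Does q S' S'' T') : Does (seq p q) S S'' (T + T') := by
  obtain ⟨t, ht, hp⟩ := h
  obtain ⟨t', ht', hq⟩ := h'
  exact ⟨t + t', add_le_add ht ht', hp.seq hq⟩

theorem does_emit (l : List (K × Γ)) (S : K → List Γ) : Does (emit l) S (pushes S l) 1 :=
  ⟨1, le_rfl, Exec.emit l S⟩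

theorem does_xfer {k : K} (l : List (K × (Γ → Γ))) {S : K → List Γ} {a : Γ} {w : List Γ}
    (h : S k = a :: w) : Does (xfer k l) S (pushes (update S k w) (respond l a)) 1 :=
  ⟨1, le_rfl, Exec.xfer h⟩

theorem does_loop_nil {k : K} (P : Γ → Bool) (l : List (K × (Γ → Γ))) (p : StackProg K Γ)
    {S : K → List Γ} (h : S k = []) : Does (loop k P l p) S S 1 :=
  ⟨1, le_rfl, Exec.loop_nil h⟩

theorem does_loop_exit {k : K} {P : Γ → Bool} (l : List (K × (Γ → Γ))) (p : StackProg K Γ)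
    {S : K → List Γ} {a : Γ} {w : List Γ} (h : S k = a :: w) (hP : P a = false) :
    Does (loop k P l p) S (update S k w) 1 :=
  ⟨1, le_rfl, Exec.loop_exit h hP⟩

theorem does_loop_step {k : K} {P : Γ → Bool} {l : List (K × (Γ → Γ))} {p : StackProg K Γ}
    {S S' S'' : K → List Γ} {a : Γ} {w : List Γ} {T T' : ℕ} (h : S k = a :: w) (hP : P a = true)
    (h₁ : Does p (pushes (update S k w) (respond l a)) S' T)
    (h₂ : Does (loop k P l p) S' S'' T') : Does (loop k P l p) S S'' (1 + T + T') := by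
  obtain ⟨t, ht, hp⟩ := h₁
  obtain ⟨t', ht', hq⟩ := h₂
  exact ⟨1 + t + t', by omega, Exec.loop_step h hP hp hq⟩

/-- The program that runs the programs of a list one after the other. -/
def seqAll : List (StackProg K Γ) → StackProg K Γ
  | [] => emit []
  | p :: l => seq p (seqAll l)

/-- The program that empties the stack `k`. -/
def clear (k : K) : StackProg K Γ :=
  loop k (fun _ => true) [] (emit [])

theorem does_clear (k : K) (S : K → List Γ) :
    Does (clear k) S (update S k []) (2 * (S k).length + 1) := by
  generalize hw : S k = w
  induction w generalizing S with
  | nil =>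
    have h := update_eq_self k S
    rw [hw] at h
    rw [h]
    exact does_loop_nil _ _ _ hw
  | cons a w ih =>
    have h := ih (update S k w) (by simp)
    rw [update_idem] at h
    exact (does_loop_step hw rfl (does_emit [] _) h).mono (by simp; omega)

theorem does_clear_all (l : List K) (S : K → List Γ) :
    Does (seqAll (l.map clear)) S (fun k => if k ∈ l then [] else S k)
      ((l.map fun k => 2 * (S k).length + 1).sum + 1) := by
  induction l generalizing S with
  | nil =>
    simp only [List.not_mem_nil, if_false]
    exact does_emit [] S
  | cons k l ih =>
    have h := (does_clear k S).seq (ih (update S k []))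
    convert! h.mono (T' := ((k :: l).map fun k => 2 * (S k).length + 1).sum + 1) ?_ using 1
    · funext x
      by_cases hx : x = k <;> simp [hx]
    · simp only [List.map_cons, List.sum_cons]
      have : (l.map fun x => 2 * (update S k [] x).length + 1).sum ≤
          (l.map fun x => 2 * (S x).length + 1).sum := by
        refine List.sum_le_sum fun x _ => ?_
        by_cases hx : x = k
        · subst hx; simp
        · simp [hx]
      omega

/-- The program that moves all symbols from `k` to `k'`. -/
def moveAll (k k' : K) : StackProg K Γ :=
  loop k (fun _ => true) [(k', id)] (emit [])

/-- `F x` describes the other stacks after x rounds. The body must work for arbitrary contents `u`,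
`v` of the counter pair, because each round shifts one symbol between the two. -/
theorem does_loop_count {k k' : K} (hk : k ≠ k') {p : StackProg K Γ} (F : ℕ → K → List Γ)
    {n T : ℕ} (h : ∀ x < n, ∀ u v, Does p (update (update (F x) k u) k' v)
      (update (update (F (x + 1)) k u) k' v) T) (w : List Γ) (x : ℕ) (hx : x + w.length = n)
    (v : List Γ) :
    Does (loop k (fun _ => true) [(k', id)] p) (update (update (F x) k w) k' v)
      (update (update (F n) k []) k' (w.reverse ++ v)) (w.length * (T + 1) + 1) := by
  induction w generalizing x v with
  | nil =>
    obtain rfl : x = n := by simpa using hx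
    exact (does_loop_nil _ _ _ (by simp [hk])).mono (by simp)
  | cons a w ih =>
    have h1 := h x (by simp at hx; omega) w (a :: v)
    have h2 := ih (x + 1) (by simp at hx; omega) (a :: v)
    have h3 := does_loop_step (l := [(k', id)]) (P := fun _ => true)
      (S := update (update (F x) k (a :: w)) k' v) (k := k) (a := a) (w := w)
      (by simp [hk]) rfl (by
        convert! h1 using 1
        simp only [respond, pushes, List.map_cons, List.map_nil, id]
        simp [update_comm hk, hk.symm]) h2
    simp only [List.reverse_cons, List.append_assoc, List.singleton_append]
    exact h3.mono (by simp; ring_nf; omega)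

theorem does_moveAll {k k' : K} (hk : k ≠ k') (S : K → List Γ) :
    Does (moveAll k k') S (update (update S k []) k' ((S k).reverse ++ S k'))
      (2 * (S k).length + 1) := by
  have h := does_loop_count hk (p := emit []) (fun _ => S) (n := (S k).length) (T := 1)
    (fun _ _ _ _ => does_emit [] _) (S k) 0 (by simp) (S k')
  simp only [update_eq_self] at h
  exact h.mono (by omega)

/-- Run `p` as many times as the counter `k` says, using `k'` to restore the counter. -/
def forLoop (k k' : K) (p : StackProg K Γ) : StackProg K Γ :=
  seq (loop k (fun _ => true) [(k', id)] p) (moveAll k' k)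

/-- A time bound for a loop that runs `n` times a program with time bound `T`. -/
def forTime (n T : ℕ) : ℕ := n * (T + 3) + 2

theorem does_forLoop {k k' : K} (hk : k ≠ k') {p : StackProg K Γ} (F : ℕ → K → List Γ)
    {n T : ℕ} (h : ∀ x < n, ∀ u v, Does p (update (update (F x) k u) k' v)
      (update (update (F (x + 1)) k u) k' v) T) (w : List Γ) (hw : w.length = n) :
    Does (forLoop k k' p) (update (update (F 0) k w) k' []) (update (update (F n) k w) k' [])
      (forTime n T) := by
  have h1 := does_loop_count hk F h w 0 (by omega) []
  have h2 := does_moveAll hk.symm (update (update (F n) k []) k' (w.reverse ++ []))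
  convert! (h1.seq h2).mono ?_ using 1
  · simp [hk, update_comm hk]
  · simp [forTime, hw]; ring_nf; omega

end StackProg

/-! ### Value tables and their recursive structure. -/

section Table

variable {α : Type}

/-- The value table of a function on tuples; the tuple `t` stands at position
`∑ j, t j * n ^ j`. -/
def tableOf (n k : ℕ) (T : (Fin k → Fin n) → α) : List α :=
  List.ofFn fun c : Fin (n ^ k) => T (finFunctionFinEquiv.symm c)

@[simp]
theorem length_tableOf (n k : ℕ) (T : (Fin k → Fin n) → α) : (tableOf n k T).length = n ^ k := by
  simp [tableOf]

theorem tableOf_zero (n : ℕ) (T : (Fin 0 → Fin n) → α) : tableOf n 0 T = [T Fin.elim0] := by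
  simp only [tableOf, pow_zero, List.ofFn_succ, List.ofFn_zero]
  congr 2
  exact Subsingleton.elim _ _

/-- The last coordinate is the most significant digit of the position, so fixing it cuts out a
contiguous block. -/
theorem tableOf_succ (n k : ℕ) (T : (Fin (k + 1) → Fin n) → α) :
    tableOf n (k + 1) T =
      (List.ofFn fun x : Fin n => tableOf n k fun v => T (Fin.snoc v x)).flatten := by
  have h := List.ofFn_mul' (m := n ^ k) (n := n)
    fun c => T (finFunctionFinEquiv.symm (Fin.cast (pow_succ n k).symm c))
  rw [tableOf, List.ofFn_congr (pow_succ n k), h]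
  congr 2
  funext x
  simp only [tableOf]
  congr 1
  funext c
  congr 1
  rw [Equiv.symm_apply_eq]
  apply Fin.ext
  rw [finFunctionFinEquiv_apply, Fin.sum_univ_castSucc]
  have h2 := congrArg Fin.val (finFunctionFinEquiv.apply_symm_apply c)
  rw [finFunctionFinEquiv_apply] at h2
  simp only [Fin.snoc_castSucc, Fin.snoc_last, Fin.val_castSucc, Fin.val_last, h2]
  simp [add_comm, mul_comm]

/-- The function on tuples over `Fin (N * n)` obtained from `T` by replacing every element by `N`
copies; the label of a tuple of copies depends on the indices of the copies through `φ`. -/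
def expand {N n k : ℕ} (φ : (Fin k → Fin N) → α → α) (T : (Fin k → Fin n) → α)
    (e : Fin k → Fin (N * n)) : α :=
  φ (fun j => (finProdFinEquiv.symm (e j)).1) (T fun j => (finProdFinEquiv.symm (e j)).2)

/-- `finProdFinEquiv` places the pair (i, x) at x + n * i, so for each copy index i all original x
are run through in order. The expansion thus arises from N full passes over the old table. -/
theorem tableOf_expand_succ {N n k : ℕ} (φ : (Fin (k + 1) → Fin N) → α → α)
    (T : (Fin (k + 1) → Fin n) → α) :
    tableOf (N * n) (k + 1) (expand φ T) =
      (List.ofFn fun i : Fin N => (List.ofFn fun x : Fin n =>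
        tableOf (N * n) k (expand (fun v => φ (Fin.snoc v i)) fun v => T (Fin.snoc v x))
          ).flatten).flatten := by
  have key : ∀ f : Fin (N * n) → List α, (List.ofFn f).flatten =
      (List.ofFn fun i : Fin N =>
        (List.ofFn fun x : Fin n => f (finProdFinEquiv (i, x))).flatten).flatten := by
    intro f
    rw [List.ofFn_mul, List.flatten_flatten, List.map_ofFn]
    congr 2
    funext i
    simp only [Function.comp_apply]
    congr 2
    funext x
    congr 1
    apply Fin.ext
    simp [finProdFinEquiv, add_comm, mul_comm]
  rw [tableOf_succ, key]
  congr 2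
  funext i
  congr 2
  funext x
  congr 1
  funext v
  simp only [expand]
  congr 1
  · funext j
    refine Fin.lastCases ?_ (fun j => ?_) j <;> simp
  · congr 1
    funext j
    refine Fin.lastCases ?_ (fun j => ?_) j <;> simp

end Table

/-! ### A stack program expanding value tables. -/

/-- The stacks of the machine that expands value tables: two tapes between which a table is moved
to and fro, the reversed output, the output, and pairs of counters. -/
inductive ExpandStack (m : ℕ) where
  | tape (s : Bool)
  | out
  | res
  | cnt (j : Fin m) (s : Bool)
  deriving DecidableEq, Fintype

namespace ExpandStack

open Function StackProg

variable {m : ℕ} {Γ : Type}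

/-- The stacks with given contents. -/
def store (s : Bool) (a b o : List Γ) (c d : Fin m → List Γ) : ExpandStack m → List Γ
  | tape x => if x = s then a else b
  | out => o
  | res => []
  | cnt j x => if x then d j else c j

theorem store_not (s : Bool) (a b o : List Γ) (c d : Fin m → List Γ) :
    store (!s) a b o c d = store s b a o c d := by
  funext k
  cases k with
  | tape x => cases x <;> cases s <;> rfl
  | _ => rfl

theorem update_counters (s : Bool) (a b o u v : List Γ) (c d : Fin m → List Γ) (j : Fin m) :
    update (update (store s a b o c d) (cnt j false) u) (cnt j true) v =
      store s a b o (update c j u) (update d j v) := by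
  funext k
  cases k with
  | cnt l x =>
    by_cases hl : l = j
    · subst hl; cases x <;> simp [store, update]
    · cases x <;> simp [store, hl]
  | _ => simp [store]

theorem update_tapes (s : Bool) (a a' b b' o : List Γ) (c d : Fin m → List Γ) :
    update (update (store s a b o c d) (tape s) a') (tape (!s)) b' = store s a' b' o c d := by
  funext k
  cases k with
  | tape x => cases x <;> cases s <;> simp [store, update]
  | _ => simp [store]

theorem update_out (s : Bool) (a b o o' : List Γ) (c d : Fin m → List Γ) :
    update (store s a b o c d) out o' = store s a b o' c d := by
  funext k
  cases k <;> simp [store]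

/-- Loop over the elements of the domain, using the `j`-th pair of counters. -/
theorem does_forLoop_cnt {p : StackProg (ExpandStack m) Γ} (j : Fin m) {n T : ℕ} {s : Bool}
    (A B O : ℕ → List Γ) {c d : Fin m → List Γ} (hc : (c j).length = n) (hd : d j = [])
    (h : ∀ x < n, ∀ u v, Does p (store s (A x) (B x) (O x) (update c j u) (update d j v))
      (store s (A (x + 1)) (B (x + 1)) (O (x + 1)) (update c j u) (update d j v)) T) :
    Does (forLoop (cnt j false) (cnt j true) p) (store s (A 0) (B 0) (O 0) c d)
      (store s (A n) (B n) (O n) c d) (forTime n T) := by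
  have h1 := does_forLoop (k := cnt j false) (k' := cnt j true) (by simp)
    (fun x => store s (A x) (B x) (O x) c d) (by simpa only [update_counters] using h) (c j) hc
  simpa only [update_counters, update_eq_self, ← hd] using h1

/-- Move a block of `n ^ j` symbols from one tape to the other. -/
def moveBlock (s : Bool) : (j : ℕ) → j ≤ m → StackProg (ExpandStack m) Γ
  | 0, _ => xfer (tape s) [(tape (!s), id)]
  | j + 1, hj =>
    forLoop (cnt ⟨j, hj⟩ false) (cnt ⟨j, hj⟩ true) (moveBlock s j (Nat.le_of_succ_le hj))

/-- A time bound for `moveBlock`. -/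
def moveTime (n : ℕ) : ℕ → ℕ
  | 0 => 1
  | j + 1 => forTime n (moveTime n j)

/-- Nested loops measure out the power of n. Only counters below `j` are constrained, so the block
can be moved while outer loops are under way. -/
theorem does_moveBlock (s : Bool) (j : ℕ) (hj : j ≤ m) {n : ℕ} {c d : Fin m → List Γ}
    (hc : ∀ l : Fin m, (l : ℕ) < j → (c l).length = n) (hd : ∀ l : Fin m, (l : ℕ) < j → d l = [])
    (w a b o : List Γ) (hw : w.length = n ^ j) :
    Does (moveBlock s j hj) (store s (w ++ a) b o c d) (store s a (w.reverse ++ b) o c d)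
      (moveTime n j) := by
  induction j generalizing c d w a b with
  | zero =>
    obtain ⟨x, rfl⟩ := List.length_eq_one_iff.1 (by simpa using hw)
    convert! does_xfer (k := tape s) [(tape (!s), id)] (a := x) (w := a) ?_ using 1
    · simp only [respond, List.map_cons, List.map_nil, pushes]
      rw [update_tapes]
      cases s <;> simp [store]
    · simp [store]
  | succ j ih =>
    -- After x rounds the first x * n ^ j symbols have changed tapes, in reversed order.
    have h := does_forLoop_cnt (p := moveBlock s j (Nat.le_of_succ_le hj)) ⟨j, hj⟩
      (n := n) (T := moveTime n j) (s := s)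
      (fun x => w.drop (x * n ^ j) ++ a) (fun x => (w.take (x * n ^ j)).reverse ++ b)
      (fun _ => o) (hc ⟨j, hj⟩ (Nat.lt_succ_self j)) (hd ⟨j, hj⟩ (Nat.lt_succ_self j)) ?_
    · have hw' : w.length ≤ n * n ^ j := by rw [hw, pow_succ, mul_comm]
      rw [moveBlock, moveTime]
      simpa [List.drop_eq_nil_of_le hw', List.take_of_length_le hw'] using h
    · intro x hx u v
      have hle : x * n ^ j + n ^ j ≤ w.length := by
        rw [hw, pow_succ, mul_comm _ n, ← Nat.succ_mul]
        exact Nat.mul_le_mul_right _ hx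
      convert! ih (c := update c ⟨j, hj⟩ u) (d := update d ⟨j, hj⟩ v) (Nat.le_of_succ_le hj)
        (fun l hl => ?_) (fun l hl => ?_) ((w.drop (x * n ^ j)).take (n ^ j))
        (w.drop ((x + 1) * n ^ j) ++ a) ((w.take (x * n ^ j)).reverse ++ b) ?_ using 2
      · rw [← List.append_assoc, Nat.succ_mul, ← List.drop_drop, List.take_append_drop]
      · rw [← List.append_assoc, ← List.reverse_append, Nat.succ_mul, List.take_add]
      · rw [update_of_ne (by intro h; simp [h] at hl)]
        exact hc l (Nat.lt_succ_of_lt hl)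
      · rw [update_of_ne (by intro h; simp [h] at hl)]
        exact hd l (Nat.lt_succ_of_lt hl)
      · simp; omega

/-- Read a value table and write the table of its expansion. -/
def expandBlock {N : ℕ} :
    (j : ℕ) → j ≤ m → ((Fin j → Fin N) → Γ → Γ) → StackProg (ExpandStack m) Γ
  | 0, _, φ => xfer (tape false) [(tape true, id), (out, φ Fin.elim0)]
  | j + 1, hj, φ =>
    seq
      (seqAll ((List.finRange N).map fun i =>
        seq
          (forLoop (cnt ⟨j, hj⟩ false) (cnt ⟨j, hj⟩ true)
            (expandBlock j (Nat.le_of_succ_le hj) fun v => φ (Fin.snoc v i)))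
          (moveBlock true (j + 1) hj)))
      (moveBlock false (j + 1) hj)

/-- A time bound for `expandBlock`. -/
def expandTime (N n : ℕ) : ℕ → ℕ
  | 0 => 1
  | j + 1 => N * (forTime n (expandTime N n j) + moveTime n (j + 1)) + 1 + moveTime n (j + 1)

/-- The block read ends up reversed on the other tape, so an enclosing loop finds the next block on
top and can later rewind all of them at once. The output also accumulates in reverse. -/
theorem does_expandBlock {N : ℕ} (j : ℕ) (hj : j ≤ m) (φ : (Fin j → Fin N) → Γ → Γ) {n : ℕ}
    (T : (Fin j → Fin n) → Γ) {c d : Fin m → List Γ}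
    (hc : ∀ l : Fin m, (l : ℕ) < j → (c l).length = n) (hd : ∀ l : Fin m, (l : ℕ) < j → d l = [])
    (a b o : List Γ) :
    Does (expandBlock j hj φ) (store false (tableOf n j T ++ a) b o c d)
      (store false a ((tableOf n j T).reverse ++ b)
        ((tableOf (N * n) j (expand φ T)).reverse ++ o) c d) (expandTime N n j) := by
  induction j generalizing c d a b o with
  | zero =>
    convert! does_xfer (k := tape false) [(tape true, id), (out, φ Fin.elim0)]
      (a := T Fin.elim0) (w := a) ?_ using 1
    · simp only [respond, List.map_cons, List.map_nil, pushes]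
      have h := update_tapes false (tableOf n 0 T ++ a) a b (T Fin.elim0 :: b) o c d
      rw [Bool.not_false] at h
      simp only [id]
      have h1 : ∀ u, update (store false (tableOf n 0 T ++ a) b o c d) (tape false) u (tape true) =
        b := by intro u; simp [store]
      rw [h1, h, update_out]
      simp only [tableOf_zero, expand]
      simp only [store, List.reverse_singleton, List.singleton_append]
      congr
      · exact Subsingleton.elim _ _
      · exact Subsingleton.elim _ _
    · simp [store, tableOf_zero]
  | succ j ih =>
    -- One pass over the table, with the copy index of the last coordinate fixed to `i`.
    have hloop : ∀ (i : Fin N) (o : List Γ),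
        Does (forLoop (cnt ⟨j, hj⟩ false) (cnt ⟨j, hj⟩ true)
            (expandBlock j (Nat.le_of_succ_le hj) fun v => φ (Fin.snoc v i)))
          (store false (tableOf n (j + 1) T ++ a) b o c d)
          (store false a ((tableOf n (j + 1) T).reverse ++ b)
            ((List.ofFn fun x : Fin n => tableOf (N * n) j
              (expand (fun v => φ (Fin.snoc v i)) fun v => T (Fin.snoc v x))).flatten.reverse ++ o)
            c d) (forTime n (expandTime N n j)) := by
      intro i o
      rw [tableOf_succ]
      set bl : List (List Γ) := List.ofFn fun x : Fin n => tableOf n j fun v => T (Fin.snoc v x)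
        with hbl
      set ol : List (List Γ) := List.ofFn fun x : Fin n => tableOf (N * n) j
        (expand (fun v => φ (Fin.snoc v i)) fun v => T (Fin.snoc v x)) with hol
      have h := does_forLoop_cnt
        (p := expandBlock j (Nat.le_of_succ_le hj) fun v => φ (Fin.snoc v i)) ⟨j, hj⟩
        (n := n) (T := expandTime N n j) (s := false)
        (fun x => (bl.drop x).flatten ++ a) (fun x => (bl.take x).flatten.reverse ++ b)
        (fun x => (ol.take x).flatten.reverse ++ o)
        (hc ⟨j, hj⟩ (Nat.lt_succ_self j)) (hd ⟨j, hj⟩ (Nat.lt_succ_self j)) ?_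
      · have h1 : bl.length ≤ n := by simp [hbl]
        have h2 : ol.length ≤ n := by simp [hol]
        simpa only [List.drop_zero, List.take_zero, List.flatten_nil, List.reverse_nil,
          List.nil_append, List.drop_eq_nil_of_le h1, List.take_of_length_le h1,
          List.take_of_length_le h2] using h
      · intro x hx u v
        have h1 : x < bl.length := by simpa [hbl] using hx
        have h2 : x < ol.length := by simpa [hol] using hx
        have h3 : bl[x] = tableOf n j fun v => T (Fin.snoc v ⟨x, hx⟩) := by simp [hbl]
        have h4 : ol[x] = tableOf (N * n) j
            (expand (fun v => φ (Fin.snoc v i)) fun v => T (Fin.snoc v ⟨x, hx⟩)) := by simp [hol]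
        convert! ih (c := update c ⟨j, hj⟩ u) (d := update d ⟨j, hj⟩ v) (Nat.le_of_succ_le hj)
          (fun v => φ (Fin.snoc v i)) (fun v => T (Fin.snoc v ⟨x, hx⟩))
          (fun l hl => ?_) (fun l hl => ?_) ((bl.drop (x + 1)).flatten ++ a)
          ((bl.take x).flatten.reverse ++ b) ((ol.take x).flatten.reverse ++ o) using 2
        · rw [List.drop_eq_getElem_cons h1, List.flatten_cons, h3, List.append_assoc]
        · rw [← List.take_append_getElem h1, List.flatten_append, h3]
          simp
        · rw [← List.take_append_getElem h2, List.flatten_append, h4]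
          simp
        · rw [update_of_ne (by intro h; simp [h] at hl)]
          exact hc l (Nat.lt_succ_of_lt hl)
        · rw [update_of_ne (by intro h; simp [h] at hl)]
          exact hd l (Nat.lt_succ_of_lt hl)
    -- Rewinding: a second reversal restores the table. The move goes the other way, so `store_not`
    -- exchanges the roles of the tapes.
    have hback : ∀ o : List Γ, Does (moveBlock true (j + 1) hj)
        (store false a ((tableOf n (j + 1) T).reverse ++ b) o c d)
        (store false (tableOf n (j + 1) T ++ a) b o c d) (moveTime n (j + 1)) := by
      intro o
      have h := does_moveBlock true (j + 1) hj hc hd (tableOf n (j + 1) T).reverse b a o (by simp)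
      rw [← Bool.not_false, store_not, store_not, List.reverse_reverse] at h
      exact h
    have hall : ∀ (l : List (Fin N)) (o : List Γ),
        Does (seqAll (l.map fun i =>
            seq
              (forLoop (cnt ⟨j, hj⟩ false) (cnt ⟨j, hj⟩ true)
                (expandBlock j (Nat.le_of_succ_le hj) fun v => φ (Fin.snoc v i)))
              (moveBlock true (j + 1) hj)))
          (store false (tableOf n (j + 1) T ++ a) b o c d)
          (store false (tableOf n (j + 1) T ++ a) b
            ((l.map fun i => (List.ofFn fun x : Fin n => tableOf (N * n) j
              (expand (fun v => φ (Fin.snoc v i)) fun v => T (Fin.snoc v x))).flatten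
                ).flatten.reverse ++ o) c d)
          (l.length * (forTime n (expandTime N n j) + moveTime n (j + 1)) + 1) := by
      intro l
      induction l with
      | nil => exact fun o => (does_emit [] _).mono (by simp)
      | cons i l ihl =>
        intro o
        have h := ((hloop i o).seq (hback _)).seq (ihl _)
        simp only [List.map_cons, List.flatten_cons, List.reverse_append, List.append_assoc]
          at h ⊢
        exact h.mono (by simp; ring_nf; omega)
    -- After the last pass the table has been rewound once more; a final move puts it behind the
    -- reading position, as the invariant requires.
    have hfwd := does_moveBlock false (j + 1) hj hc hd (tableOf n (j + 1) T) a b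
      ((tableOf (N * n) (j + 1) (expand φ T)).reverse ++ o) (by simp)
    have h := hall (List.finRange N) o
    rw [← List.ofFn_eq_map (n := N) (f := fun i => List.flatten _), ← tableOf_expand_succ,
      List.length_finRange] at h
    exact h.seq hfwd

end ExpandStack

/-! ### Polynomial bounds for the running times. -/

/-- Functions on the natural numbers with a polynomial upper bound. -/
def PolyBounded (f : ℕ → ℕ) : Prop :=
  ∃ P : Polynomial ℕ, ∀ n, f n ≤ P.eval n

namespace PolyBounded

theorem const (c : ℕ) : PolyBounded fun _ => c :=
  ⟨Polynomial.C c, fun n => by simp⟩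

theorem id : PolyBounded fun n => n :=
  ⟨Polynomial.X, fun n => by simp⟩

theorem add {f g : ℕ → ℕ} (hf : PolyBounded f) (hg : PolyBounded g) :
    PolyBounded fun n => f n + g n := by
  obtain ⟨P, hP⟩ := hf
  obtain ⟨Q, hQ⟩ := hg
  exact ⟨P + Q, fun n => by simpa using add_le_add (hP n) (hQ n)⟩

theorem mul {f g : ℕ → ℕ} (hf : PolyBounded f) (hg : PolyBounded g) :
    PolyBounded fun n => f n * g n := by
  obtain ⟨P, hP⟩ := hf
  obtain ⟨Q, hQ⟩ := hg
  exact ⟨P * Q, fun n => by simpa using Nat.mul_le_mul (hP n) (hQ n)⟩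

theorem pow {f : ℕ → ℕ} (hf : PolyBounded f) (k : ℕ) : PolyBounded fun n => f n ^ k := by
  induction k with
  | zero => simpa using const 1
  | succ k ih => simpa only [pow_succ] using ih.mul hf

theorem listSum {ι : Type} (l : List ι) {f : ι → ℕ → ℕ} (hf : ∀ i, PolyBounded (f i)) :
    PolyBounded fun n => (l.map fun i => f i n).sum := by
  induction l with
  | nil => simpa using const 0
  | cons i l ih => simpa using (hf i).add ih

theorem forTime {f : ℕ → ℕ} (hf : PolyBounded f) :
    PolyBounded fun n => StackProg.forTime n (f n) :=
  (id.mul (hf.add (const 3))).add (const 2)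

theorem moveTime (j : ℕ) : PolyBounded fun n => ExpandStack.moveTime n j := by
  induction j with
  | zero => exact const 1
  | succ j ih => exact ih.forTime

/-- The nesting depth `j` and the number `N` of passes are constants; only the domain size varies.
-/
theorem expandTime (N j : ℕ) : PolyBounded fun n => ExpandStack.expandTime N n j := by
  induction j with
  | zero => exact const 1
  | succ j ih =>
    exact (((const N).mul (ih.forTime.add (moveTime (j + 1)))).add (const 1)).add
      (moveTime (j + 1))

end PolyBounded

theorem StackProg.pushes_apply {K Γ : Type} [DecidableEq K] (S : K → List Γ) (l : List (K × Γ))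
    (k : K) :
    pushes S l k = ((l.filter fun x => x.1 = k).map Prod.snd).reverse ++ S k := by
  induction l generalizing S with
  | nil => rfl
  | cons x l ih =>
    rw [pushes, ih]
    by_cases hx : x.1 = k
    · subst hx; simp
    · simp [hx, Function.update_of_ne (Ne.symm hx)]

/-! ### Blowing up structures in polynomial time. -/

namespace StarStructure

variable {σ : Signature} {N : ℕ}

/-- Replace every element by `N` copies; the label of a tuple of copies is obtained from the label
of the original tuple and the indices of the copies by means of `φ`. -/
def copies (φ : (i : Fin σ.numSymbols) → (Fin (σ.arity i) → Fin N) → Label → Label)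
    (G : StarStructure σ) : StarStructure σ where
  size := N * G.size
  rel i := expand (φ i) (G.rel i)

/-- Apply a map to the labels among the symbols. -/
def mapLabel (f : Label → Label) : StructSymbol → StructSymbol
  | StructSymbol.lab l => StructSymbol.lab (f l)
  | s => s

theorem table_eq_tableOf (G : StarStructure σ) (i : Fin σ.numSymbols) :
    G.table i = tableOf G.size (σ.arity i) fun t => StructSymbol.lab (G.rel i t) := rfl

theorem table_copies (φ : (i : Fin σ.numSymbols) → (Fin (σ.arity i) → Fin N) → Label → Label)
    (G : StarStructure σ) (i : Fin σ.numSymbols) :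
    (G.copies φ).table i = tableOf (N * G.size) (σ.arity i)
      (expand (fun v => mapLabel (φ i v)) fun t => StructSymbol.lab (G.rel i t)) := rfl

theorem encode_eq (G : StarStructure σ) :
    G.encode = List.replicate G.size StructSymbol.tick ++ StructSymbol.sep ::
      ((List.finRange σ.numSymbols).map G.table).flatten := by
  rw [encode, List.ofFn_eq_map]

theorem length_tables (G : StarStructure σ) (l : List (Fin σ.numSymbols)) :
    (l.map G.table).flatten.length = (l.map fun i => G.size ^ σ.arity i).sum := by
  induction l with
  | nil => rfl
  | cons i l ih => simp [ih, table_eq_tableOf]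

open StackProg ExpandStack Function

/-- The largest arity of a symbol. -/
def _root_.Signature.maxArity (σ : Signature) : ℕ :=
  Finset.univ.sup σ.arity

theorem _root_.Signature.arity_le (σ : Signature) (i : Fin σ.numSymbols) :
    σ.arity i ≤ σ.maxArity :=
  Finset.le_sup (Finset.mem_univ i)

/-- What is pushed for every tick of the input: a tick on every counter, and `N` ticks of the
output. -/
def tickPushes (m N : ℕ) : List (ExpandStack m × (StructSymbol → StructSymbol)) :=
  (List.finRange m).map (fun j => (cnt j false, fun a => a)) ++
    List.replicate N (out, fun a => a)

/-- Read the size of a structure and write `N` times this size. -/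
def sizeProg (m N : ℕ) : StackProg (ExpandStack m) StructSymbol :=
  loop (tape false) (fun a => a = StructSymbol.tick) (tickPushes m N) (emit [])

/-- The program that computes `copies φ`. -/
def copiesProg (φ : (i : Fin σ.numSymbols) → (Fin (σ.arity i) → Fin N) → Label → Label) :
    StackProg (ExpandStack σ.maxArity) StructSymbol :=
  seq (sizeProg σ.maxArity N) <|
    seq (emit [(out, StructSymbol.sep)]) <|
      seq (seqAll ((List.finRange σ.numSymbols).map fun i =>
        expandBlock (σ.arity i) (σ.arity_le i) fun v => mapLabel (φ i v))) <|
        seq (moveAll out res) <|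
          seqAll ((tape true :: (List.finRange σ.maxArity).map fun j => cnt j false).map clear)

theorem pushes_tickPushes {m : ℕ} (N : ℕ) (s : Bool) (a : StructSymbol)
    (u b o : List StructSymbol) (c d : Fin m → List StructSymbol) :
    pushes (store s u b o c d) (respond (tickPushes m N) a) =
      store s u b (List.replicate N a ++ o) (fun j => a :: c j) d := by
  funext k
  rw [pushes_apply]
  simp only [respond, tickPushes, List.map_append, List.map_map, List.filter_append,
    List.filter_map, List.map_replicate, List.filter_replicate]
  cases k with
  | cnt l x =>
    cases x
    · have h : (List.finRange m).filter (fun j => decide (j = l)) = [l] := by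
        refine (List.filter_congr fun j _ => (beq_eq_decide j l).symm).trans ?_
        rw [List.filter_beq, List.count_eq_one_of_mem (List.nodup_finRange m)
          (List.mem_finRange l)]
        rfl
      simp [comp_def, store, h]
    · simp [comp_def, store]
  | _ => simp [comp_def, store]

theorem does_sizeProg {m : ℕ} (N n : ℕ) (u b o : List StructSymbol)
    (c d : Fin m → List StructSymbol) :
    Does (sizeProg m N)
      (store false (List.replicate n StructSymbol.tick ++ StructSymbol.sep :: u) b o c d)
      (store false u b (List.replicate (N * n) StructSymbol.tick ++ o)
        (fun j => List.replicate n StructSymbol.tick ++ c j) d) (2 * n + 1) := by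
  have hupd : ∀ (a u o : List StructSymbol) (c : Fin m → List StructSymbol),
      update (store false a b o c d) (tape false) u = store false u b o c d := by
    intro a u o c
    funext k
    cases k with
    | tape x => cases x <;> simp [store, update]
    | _ => simp [store]
  induction n generalizing o c with
  | zero =>
    -- The failing test also pops its symbol, which disposes of the separator.
    convert! does_loop_exit (k := tape false) (tickPushes m N) (emit [])
      (a := StructSymbol.sep) (w := u) ?_ ?_ using 1
    · simp [hupd]
    · simp [store]
    · simp
  | succ n ih =>
    have h := ih (List.replicate N StructSymbol.tick ++ o) (fun j => StructSymbol.tick :: c j)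
    have h1 := does_loop_step (k := tape false) (P := fun a => decide (a = StructSymbol.tick))
      (l := tickPushes m N) (a := StructSymbol.tick)
      (w := List.replicate n StructSymbol.tick ++ StructSymbol.sep :: u)
      (S := store false (List.replicate (n + 1) StructSymbol.tick ++ StructSymbol.sep :: u) b o c d)
      (by simp [store, List.replicate_succ]) (by simp) (does_emit [] _)
      (by rw [hupd, pushes_tickPushes]; exact h)
    convert! h1.mono (T' := 2 * (n + 1) + 1) (by omega) using 2
    · rw [← List.append_assoc, List.replicate_append_replicate, Nat.mul_succ]
    · funext j
      rw [List.replicate_succ', List.append_assoc]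
      rfl

theorem does_tables (φ : (i : Fin σ.numSymbols) → (Fin (σ.arity i) → Fin N) → Label → Label)
    (G : StarStructure σ) {c d : Fin σ.maxArity → List StructSymbol}
    (hc : ∀ j, (c j).length = G.size) (hd : ∀ j, d j = []) (l : List (Fin σ.numSymbols))
    (a b o : List StructSymbol) :
    Does (seqAll (l.map fun i =>
        expandBlock (σ.arity i) (σ.arity_le i) fun v => mapLabel (φ i v)))
      (store false ((l.map G.table).flatten ++ a) b o c d)
      (store false a ((l.map G.table).flatten.reverse ++ b)
        ((l.map (G.copies φ).table).flatten.reverse ++ o) c d)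
      ((l.map fun i => expandTime N G.size (σ.arity i)).sum + 1) := by
  induction l generalizing b o with
  | nil => exact does_emit [] _
  | cons i l ih =>
    have h := (does_expandBlock (σ.arity i) (σ.arity_le i) (fun v => mapLabel (φ i v))
      (fun t => StructSymbol.lab (G.rel i t)) (c := c) (d := d) (fun j _ => hc j) (fun j _ => hd j)
      ((l.map G.table).flatten ++ a) b o).seq (ih _ _)
    rw [← table_eq_tableOf, ← table_copies] at h
    simp only [List.map_cons, List.flatten_cons, List.reverse_append, List.append_assoc,
      List.sum_cons, add_assoc] at h ⊢
    exact h

/-- A time bound for `copiesProg`. -/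
def copiesTime (σ : Signature) (N n : ℕ) : ℕ :=
  (2 * n + 1) + (1 + ((((List.finRange σ.numSymbols).map
    fun i => expandTime N n (σ.arity i)).sum + 1) +
      ((2 * (N * n + 1 + ((List.finRange σ.numSymbols).map
        fun i => (N * n) ^ σ.arity i).sum) + 1) +
        ((2 * ((List.finRange σ.numSymbols).map fun i => n ^ σ.arity i).sum + 1) +
          σ.maxArity * (2 * n + 1) + 1))))

theorem polyBounded_copiesTime (σ : Signature) (N : ℕ) : PolyBounded (copiesTime σ N) := by
  have hn := PolyBounded.id
  have hN := (PolyBounded.const N).mul hn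
  have hlin : ∀ {f : ℕ → ℕ}, PolyBounded f → PolyBounded fun n => 2 * f n + 1 :=
    fun hf => ((PolyBounded.const 2).mul hf).add (PolyBounded.const 1)
  exact (hlin hn).add ((PolyBounded.const 1).add
    (((PolyBounded.listSum _ fun i => PolyBounded.expandTime N (σ.arity i)).add
      (PolyBounded.const 1)).add
      ((hlin ((hN.add (PolyBounded.const 1)).add (PolyBounded.listSum _ fun i =>
        hN.pow (σ.arity i)))).add
        (((hlin (PolyBounded.listSum _ fun i => hn.pow (σ.arity i))).add
          ((PolyBounded.const σ.maxArity).mul (hlin hn))).add (PolyBounded.const 1)))))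

/-- Moving `out` to `res` puts the reversed output in order. The machine must halt with all other
stacks empty, so the used-up input and the counters are cleared. -/
theorem does_copiesProg (φ : (i : Fin σ.numSymbols) → (Fin (σ.arity i) → Fin N) → Label → Label)
    (G : StarStructure σ) :
    Does (copiesProg φ) (fun k => if k = tape false then G.encode else [])
      (fun k => if k = res then (G.copies φ).encode else []) (copiesTime σ N G.size) := by
  set tabs := ((List.finRange σ.numSymbols).map G.table).flatten with htabs
  set tabs' := ((List.finRange σ.numSymbols).map (G.copies φ).table).flatten with htabs'
  set c : Fin σ.maxArity → List StructSymbol :=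
    fun _ => List.replicate G.size StructSymbol.tick with hc
  have h0 : (fun k => if k = tape false then G.encode else []) =
      store (m := σ.maxArity) false (List.replicate G.size StructSymbol.tick ++
        StructSymbol.sep :: tabs) [] [] (fun _ => []) (fun _ => []) := by
    funext k
    cases k with
    | tape x => cases x <;> simp [store, encode_eq, htabs]
    | cnt j x => cases x <;> simp [store]
    | _ => simp [store]
  have h1 := does_sizeProg (m := σ.maxArity) N G.size tabs [] [] (fun _ => []) (fun _ => [])
  simp only [List.append_nil] at h1
  have h2 := does_emit [(out, StructSymbol.sep)] (store (m := σ.maxArity) false tabs []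
    (List.replicate (N * G.size) StructSymbol.tick) c (fun _ => []))
  have h3 := does_tables φ G (c := c) (d := fun _ => []) (by simp [hc]) (by simp)
    (List.finRange σ.numSymbols) [] []
    (StructSymbol.sep :: List.replicate (N * G.size) StructSymbol.tick)
  simp only [List.append_nil] at h3
  simp only [pushes, update_out] at h2
  have h4 := does_moveAll (k := out) (k' := res) (by simp) (store (m := σ.maxArity) false []
    tabs.reverse (tabs'.reverse ++ StructSymbol.sep ::
      List.replicate (N * G.size) StructSymbol.tick) c (fun _ => []))
  have h5 := does_clear_all (tape true :: (List.finRange σ.maxArity).map fun j => cnt j false)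
    (update (update (store (m := σ.maxArity) false []
      tabs.reverse (tabs'.reverse ++ StructSymbol.sep ::
        List.replicate (N * G.size) StructSymbol.tick) c (fun _ => [])) out []) res
        ((tabs'.reverse ++ StructSymbol.sep ::
          List.replicate (N * G.size) StructSymbol.tick).reverse ++ []))
  rw [h0]
  convert! (h1.seq (h2.seq (h3.seq (h4.seq h5)))).mono ?_ using 1
  · funext k
    cases k with
    | tape x => cases x <;> simp [store]
    | res => simp [encode_eq, htabs', copies]
    | cnt j x => cases x <;> simp [store]
    | _ => simp
  · have ht : tabs.length = ((List.finRange σ.numSymbols).map fun i => G.size ^ σ.arity i).sum :=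
      G.length_tables _
    have ht' : tabs'.length =
        ((List.finRange σ.numSymbols).map fun i => (N * G.size) ^ σ.arity i).sum :=
      (G.copies φ).length_tables _
    simp only [copiesTime, ← ht, ← ht']
    simp [store, hc, comp_def]
    omega

/-- Replacing elements by copies is computable in polynomial time. -/
theorem polyTime_copies
    (φ : (i : Fin σ.numSymbols) → (Fin (σ.arity i) → Fin N) → Label → Label) {α : Type}
    {ea : α → List StructSymbol} {f : StarStructure σ → α}
    (hf : ∀ G, ea (f G) = (G.copies φ).encode) :
    Nonempty (Turing.TM2ComputableInPolyTime (encode (σ := σ)) ea f) := by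
  obtain ⟨P, hP⟩ := polyBounded_copiesTime σ N
  -- The choice is immaterial: in every execution considered, the register holds a symbol whenever a
  -- response is computed.
  have _ : Inhabited StructSymbol := ⟨StructSymbol.tick⟩
  refine StackProg.polyTime (copiesProg φ) (tape false) res P fun G => ?_
  simp only [hf]
  refine (does_copiesProg φ G).mono ((hP _).trans ?_)
  -- The size is written in unary, so a bound polynomial in the size is polynomial in the input
  -- length.
  have hle : G.size ≤ G.encode.length := by simp [encode_eq]
  rw [Polynomial.eval_eq_sum, Polynomial.eval_eq_sum]
  exact Finset.sum_le_sum fun i _ => Nat.mul_le_mul_left _ (Nat.pow_le_pow_left hle i)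

end StarStructure

/-! ### A matrix without constant blocks on selected colour classes. -/

/-- There is a square `0`-`1`-matrix such that from every colouring of its indices with `h` colours
one can select a colour class in such a way that no two selected classes, not even twice the same
one, span a constant submatrix. -/
theorem exists_matrix_forall_selection (h : ℕ) :
    ∃ (N : ℕ) (M : Fin N → Fin N → Bool) (sel : (Fin N → Fin h) → Fin h),
      ∀ (f g : Fin N → Fin h) (b : Bool), ∃ i j, f i = sel f ∧ g j = sel g ∧ M i j = b := by
  classical
  rcases Nat.eq_zero_or_pos h with rfl | hpos
  · exact ⟨1, fun _ _ => true, fun f => f 0, fun f => (f 0).elim0⟩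
  have : Nonempty (Fin h) := ⟨⟨0, hpos⟩⟩
  -- With this n there are h * (h * 2 ^ n) indices, so some class has at least h * 2 ^ n of them,
  -- enough to force h distinct first coordinates.
  let n := h * h
  let ι := Fin n × (Fin n → Bool)
  let e : Fin (Fintype.card ι) ≃ ι := (Fintype.equivFin ι).symm
  have hcard : Fintype.card ι = n * 2 ^ n := by simp [ι]
  have hmaj : ∀ f : Fin (Fintype.card ι) → Fin h, ∃ y, h * 2 ^ n ≤
      (Finset.univ.filter fun x => f x = y).card := by
    intro f
    obtain ⟨y, -, hy⟩ := Finset.exists_le_card_fiber_of_mul_le_card_of_maps_to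
      (s := Finset.univ) (t := Finset.univ) (f := f) (n := h * 2 ^ n) (fun _ _ => Finset.mem_univ _)
      Finset.univ_nonempty (by simp [hcard, n, mul_assoc])
    exact ⟨y, hy⟩
  choose sel hsel using hmaj
  refine ⟨Fintype.card ι, fun i j => (e j).2 (e i).1, sel, fun f g b => ?_⟩
  by_contra! hcon
  let A : Finset (Fin n) := (Finset.univ.filter fun x => f x = sel f).image fun x => (e x).1
  let B : Finset (Fin n → Bool) :=
    (Finset.univ.filter fun x => g x = sel g).image fun x => (e x).2
  have hA : h ≤ A.card := by
    have h1 : (Finset.univ.filter fun x => f x = sel f).card ≤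
        (A ×ˢ (Finset.univ : Finset (Fin n → Bool))).card := by
      refine Finset.card_le_card_of_injOn e (fun x hx => ?_) e.injective.injOn
      exact Finset.mem_product.2 ⟨Finset.mem_image_of_mem (fun x => (e x).1) hx, Finset.mem_univ _⟩
    rw [Finset.card_product] at h1
    simp only [Finset.card_univ, Fintype.card_fun, Fintype.card_bool, Fintype.card_fin] at h1
    exact Nat.le_of_mul_le_mul_right ((hsel f).trans h1) (by positivity)
  have hB : 2 ^ n ≤ h * B.card := by
    have h1 : (Finset.univ.filter fun x => g x = sel g).card ≤
        ((Finset.univ : Finset (Fin n)) ×ˢ B).card := by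
      refine Finset.card_le_card_of_injOn e (fun x hx => ?_) e.injective.injOn
      exact Finset.mem_product.2 ⟨Finset.mem_univ _, Finset.mem_image_of_mem (fun x => (e x).2) hx⟩
    rw [Finset.card_product] at h1
    simp only [Finset.card_univ, Fintype.card_fin] at h1
    have h2 := (hsel g).trans h1
    simp only [n, mul_assoc] at h2
    exact Nat.le_of_mul_le_mul_left h2 hpos
  -- If `b` is never attained, every vector in `B` is prescribed on all of `A`.
  have hsub : B ⊆ Fintype.piFinset fun i => if i ∈ A then {!b} else Finset.univ := by
    intro v hv
    rw [Fintype.mem_piFinset]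
    intro i
    split_ifs with hi
    · obtain ⟨x, hx, rfl⟩ := Finset.mem_image.1 hi
      obtain ⟨y, hy, rfl⟩ := Finset.mem_image.1 hv
      have := hcon x y (by simpa using hx) (by simpa using hy)
      simpa using Bool.eq_not.2 this
    · exact Finset.mem_univ _
  have hB' : B.card * 2 ^ A.card ≤ 2 ^ n := by
    have h1 := Finset.card_le_card hsub
    rw [Fintype.card_piFinset] at h1
    simp only [apply_ite Finset.card, Finset.card_singleton, Finset.card_univ,
      Fintype.card_bool] at h1
    rw [Finset.prod_ite, Finset.prod_const_one, one_mul, Finset.prod_const] at h1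
    refine (Nat.mul_le_mul_right _ h1).trans ?_
    rw [← pow_add]
    refine Nat.pow_le_pow_right two_pos (le_of_eq ?_)
    have h2 := Finset.card_filter_add_card_filter_not (s := (Finset.univ : Finset (Fin n)))
      (fun i => i ∈ A)
    simp only [Finset.filter_univ_mem, Finset.card_univ, Fintype.card_fin] at h2
    rwa [add_comm]
  have h3 : h < 2 ^ A.card := hA.trans_lt Nat.lt_two_pow_self
  have hBpos : 0 < B.card := by
    rcases Nat.eq_zero_or_pos B.card with h0 | h0
    · rw [h0, mul_zero] at hB
      exact absurd hB (by simp)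
    · exact h0
  have := Nat.mul_lt_mul_of_pos_left h3 hBpos
  rw [mul_comm] at hB
  omega

/-! ### Resolving stars, and the equivalences. -/

namespace StarStructure

variable {σ : Signature}

open Classical in
/-- The label of a tuple of copies: labels `0` and `1` are kept; for symbols of arity at least `2`,
a label `⋆` is resolved by means of the matrix `M`, and for the others so as to differ from the
label in `H`. -/
noncomputable def resolve (H : StarStructure σ) {N : ℕ} (M : Fin N → Fin N → Bool)
    (i : Fin σ.numSymbols) (v : Fin (σ.arity i) → Fin N) : Label → Label
  | Label.zero => Label.zero
  | Label.one => Label.one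
  | Label.star =>
    if h : 2 ≤ σ.arity i then
      if M (v ⟨0, by omega⟩) (v ⟨1, by omega⟩) then Label.one else Label.zero
    else if ∃ t, H.rel i t = Label.zero then Label.one else Label.zero

theorem resolve_ne_star (H : StarStructure σ) {N : ℕ} (M : Fin N → Fin N → Bool)
    (i : Fin σ.numSymbols) (v : Fin (σ.arity i) → Fin N) (l : Label) :
    H.resolve M i v l ≠ Label.star := by
  cases l <;> simp only [resolve] <;> (try split_ifs) <;> simp

theorem resolve_of_ne_star (H : StarStructure σ) {N : ℕ} (M : Fin N → Fin N → Bool)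
    (i : Fin σ.numSymbols) (v : Fin (σ.arity i) → Fin N) {l : Label} (hl : l ≠ Label.star) :
    H.resolve M i v l = l := by
  cases l <;> simp_all [resolve]

theorem resolve_le (H : StarStructure σ) {N : ℕ} (M : Fin N → Fin N → Bool)
    (i : Fin σ.numSymbols) (v : Fin (σ.arity i) → Fin N) (l : Label) :
    H.resolve M i v l ≤ l := by
  cases l with
  | star => exact Or.inr rfl
  | _ => exact Or.inl rfl

theorem _root_.Label.eq_star_of_le {l : Label} (h₀ : Label.zero ≤ l) (h₁ : Label.one ≤ l) :
    l = Label.star := by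
  rcases h₀ with rfl | h
  · rcases h₁ with h | h
    · cases h
    · exact h
  · exact h

/-- Forwards, project copies to their originals, since resolving only lowers labels. Backwards, each
element goes to the selected colour of its copies, and labels are checked on copies of that colour.
-/
theorem exists_hom_copies_iff (hσ : ∀ i : Fin σ.numSymbols, σ.arity i ≠ 1) (H : StarStructure σ)
    {N : ℕ} {M : Fin N → Fin N → Bool} {sel : (Fin N → Fin H.size) → Fin H.size}
    (hM : ∀ (f g : Fin N → Fin H.size) (b : Bool),
      ∃ i j, f i = sel f ∧ g j = sel g ∧ M i j = b) (G : StarStructure σ) :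
    (∃ h, G.IsHom H h) ↔ ∃ h, (G.copies (H.resolve M)).IsHom H h := by
  constructor
  · rintro ⟨h, hh⟩
    exact ⟨fun e => h (finProdFinEquiv.symm e).2, fun i t =>
      (H.resolve_le M i (fun j => (finProdFinEquiv.symm (t j)).1)
        (G.rel i fun j => (finProdFinEquiv.symm (t j)).2)).trans (hh i _)⟩
  · rintro ⟨h, hh⟩
    let f : Fin G.size → Fin N → Fin H.size := fun x i => h (finProdFinEquiv (i, x))
    have key : ∀ (i : Fin σ.numSymbols) (t : Fin (σ.arity i) → Fin G.size)
        (v : Fin (σ.arity i) → Fin N), (∀ j, f (t j) (v j) = sel (f (t j))) →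
        H.resolve M i v (G.rel i t) ≤ H.rel i fun j => sel (f (t j)) := by
      intro i t v hv
      have h1 := hh i fun j => finProdFinEquiv (v j, t j)
      simp only [copies, expand, Equiv.symm_apply_apply] at h1
      simpa only [← hv] using h1
    refine ⟨fun x => sel (f x), fun i t => ?_⟩
    have hex : ∀ x, ∃ i, f x i = sel (f x) := fun x =>
      let ⟨i, _, hi, _⟩ := hM (f x) (f x) true
      ⟨i, hi⟩
    choose w hw using hex
    by_cases hstar : G.rel i t = Label.star
    · have hres : ∀ v : Fin (σ.arity i) → Fin N, (∀ j, f (t j) (v j) = sel (f (t j))) →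
          H.resolve M i v Label.star ≤ H.rel i fun j => sel (f (t j)) := by
        intro v hv
        rw [← hstar]
        exact key i t v hv
      refine Or.inr ?_
      by_cases hk : 2 ≤ σ.arity i
      · have hb : ∀ b : Bool,
            (if b then Label.one else Label.zero) ≤ H.rel i fun j => sel (f (t j)) := by
          intro b
          obtain ⟨p, q, hp, hq, hpq⟩ := hM (f (t ⟨0, by omega⟩)) (f (t ⟨1, by omega⟩)) b
          -- The indices `p` and `q` may be chosen independently even if both coordinates carry the
          -- same element; the remaining coordinates take any copy of the selected colour.
          have h1 := hres (fun j => if (j : ℕ) = 0 then p else if (j : ℕ) = 1 then q else w (t j))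
            (fun j => by
              split_ifs with h0 h1
              · rw [show j = ⟨0, by omega⟩ from Fin.ext h0]; exact hp
              · rw [show j = ⟨1, by omega⟩ from Fin.ext h1]; exact hq
              · exact hw _)
          simpa [resolve, hk, hpq] using h1
        exact Label.eq_star_of_le (by simpa using hb false) (by simpa using hb true)
      · have h0 : σ.arity i = 0 := by have := hσ i; omega
        have : IsEmpty (Fin (σ.arity i)) := by rw [h0]; infer_instance
        have h1 := hres isEmptyElim isEmptyElim
        -- There is only one empty tuple. A star in `G` was resolved to 1 if its label in `H` is 0,
        -- and to 0 otherwise, so only ⋆ can lie above it.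
        have h2 : (∃ s, H.rel i s = Label.zero) ↔
            H.rel i (fun j => sel (f (t j))) = Label.zero :=
          ⟨fun ⟨s, hs⟩ => by rw [← hs]; congr 1; exact Subsingleton.elim _ _, fun h => ⟨_, h⟩⟩
        simp only [resolve, hk, dite_false, h2] at h1
        split_ifs at h1 with h3
        · rw [h3] at h1
          rcases h1 with h1 | h1 <;> cases h1
        · rcases h1 with h1 | h1
          · exact absurd h1.symm h3
          · exact h1
    · have h1 := key i t (fun j => w (t j)) fun j => hw _
      rwa [resolve_of_ne_star _ _ _ _ hstar] at h1

/-- Both problems encode a structure by the same word, so the identity machine suffices. -/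
theorem mp_polyReducesTo_mpStar (H : StarStructure σ) : (MP H).PolyReducesTo (MPStar H) := by
  let tm := Turing.idComputer StructSymbol
  exact ⟨Subtype.val, ⟨⟨⟨tm, Equiv.refl _, Equiv.refl _⟩, 1, fun _ =>
    ⟨⟨1, rfl⟩, by simp⟩⟩⟩, fun _ => Iff.rfl⟩

theorem mpStar_polyReducesTo_mp (hσ : ∀ i : Fin σ.numSymbols, σ.arity i ≠ 1)
    (H : StarStructure σ) : (MPStar H).PolyReducesTo (MP H) := by
  -- The matrix depends only on the size of the fixed template and is built into the machine; `sel`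
  -- serves only the correctness proof.
  obtain ⟨N, M, sel, hM⟩ := exists_matrix_forall_selection H.size
  exact ⟨fun G => ⟨G.copies (H.resolve M), fun i t => H.resolve_ne_star M i
      (fun j => (finProdFinEquiv.symm (t j)).1) (G.rel i fun j => (finProdFinEquiv.symm (t j)).2)⟩,
    polyTime_copies (H.resolve M) fun _ => rfl, exists_hom_copies_iff hσ H hM⟩

theorem mp_polyEquiv_mpStar (hσ : ∀ i : Fin σ.numSymbols, σ.arity i ≠ 1)
    (H : StarStructure σ) : (MP H).PolyEquiv (MPStar H) :=
  ⟨H.mp_polyReducesTo_mpStar, mpStar_polyReducesTo_mp hσ H⟩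

/-- Each template is matched with itself, so any property of templates is preserved. -/
theorem mpFamily_polyEquiv_mpStarFamily (hσ : ∀ i : Fin σ.numSymbols, σ.arity i ≠ 1)
    (p : StarStructure σ → Prop) : (MPFamily σ p).PolyEquiv (MPStarFamily σ p) :=
  ⟨⟨id, ⟨Turing.idComputableInPolyTime (αΓ := StructSymbol) _⟩, fun H => mp_polyEquiv_mpStar hσ H.1⟩,
    ⟨id, ⟨Turing.idComputableInPolyTime (αΓ := StructSymbol) _⟩, fun H => (mp_polyEquiv_mpStar hσ H.1).symm⟩⟩

end StarStructure

theorem mainTheorem1 (σ : Signature) (hσ : ∀ i : Fin σ.numSymbols, σ.arity i ≠ 1) :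
    (MPFamily σ StarStructure.NoStarLoop).PolyEquiv (MPStarFamily σ StarStructure.NoStarLoop) ∧
      (MPFamily σ (fun _ => True)).PolyEquiv (MPStarFamily σ (fun _ => True)) ∧
      ∀ H : StarStructure σ, (MP H).PolyEquiv (MPStar H) :=
  ⟨StarStructure.mpFamily_polyEquiv_mpStarFamily hσ _,
    StarStructure.mpFamily_polyEquiv_mpStarFamily hσ _, StarStructure.mp_polyEquiv_mpStar hσ⟩
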